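/- Let $d\ge 0$ and give $\mathbb N^d$ the product order. A subset $S$ of a poset is *connected* if it is nonempty and any two of its elements are joined by a finite sequence in $S$ in which consecutive elements are comparable; a *component* of $S$ is a maximal connected subset of $S$. An *interval* $Q\subseteq\mathbb N^d$ is a connected subset which is convex ($p\le q\le r$ with $p,r\in Q$ implies $q\in Q$), regarded as a poset with the induced order. A *subposet* $P$ of a poset $Q$ consists of a subset of $Q$ together with a partial order on it all of whose relations are relations of $Q$ (not necessarily all of them). Let $I_Q$ be the set of all $q\in Q$ such that $\{p\in Q: p<q\}$ is not connected (so the minimal elements of $Q$ lie in $I_Q$). An *initial scaffold* of $Q$ is a subposet $P$ of $Q$ with set of elements $I_Q$ such that, for each $p\in I_Q$ and each component $A$ of $\{q\in Q: q<p\}$, there is exactly one $m\in A$ for which $m<p$ is a relation of $P$. Write $|P|$ for the number of relations of $P$, including the identity relations $p\le p$, and $n(Q)$ for the number of minima (i.e. minimal elements) of $Q$. **Theorem.** For every interval $Q\subseteq\mathbb N^d$ and every initial scaffold $P$ of $Q$, both $n(Q)$ and $|P|$ are finite. Moreover, for fixed $d$: (i) If $d\le 3$, then $|P|=\Theta(n)$: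 there are constants $c,C>0$ such that $c\,n(Q)\le |P|\le C\,n(Q)$ for every interval $Q\subseteq\mathbb N^d$ and every initial scaffold $P$ of $Q$. (ii) If $d>3$, then in the worst case $|P|=\Theta(n^2)$: there are constants $c,C>0$ (which may depend on $d$) such that $|P|\le C\,n(Q)^2$ for every interval $Q\subseteq\mathbb N^d$ and every initial scaffold $P$ of $Q$, and such that for every $n\ge 1$ there is an interval $Q\subseteq\mathbb N^d$ with exactly $n$ minima which has an initial scaffold and all of whose initial scaffolds $P$ satisfy $|P|\ge c\,n^2$. -/

import Mathlib

/-- Connectedness of a subset `S` of a poset, regarded as a full subposet and hence as a thin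
category: `S` is nonempty and any two of its elements are joined by a finite path in `S` whose
consecutive elements are comparable. In particular the empty set is not connected. -/
def PosetConnected {Q : Type*} [PartialOrder Q] (S : Set Q) : Prop :=
  CategoryTheory.IsConnected S

/-- `A` is a (connected) component of `S`: a maximal connected subset of `S`. -/
def IsPosetComponent {Q : Type*} [PartialOrder Q] (S A : Set Q) : Prop :=
  Maximal (fun B : Set Q => B ⊆ S ∧ PosetConnected B) A

/-- An interval in a poset `Z`: a nonempty, connected and convex subset. (Nonemptiness is part of
connectedness; `Set.OrdConnected` is convexity.) -/
def IsPosetInterval {Z : Type*} [PartialOrder Z] (Q : Set Z) : Prop :=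
  PosetConnected Q ∧ Q.OrdConnected

/-- The set `M_Q` of minima, that is of minimal elements, of a poset `Q`. -/
def posetMinima (Q : Type*) [PartialOrder Q] : Set Q := {q | IsMin q}

/-- The set `I_Q` of all elements `q` whose open downset `{p | p < q}` is disconnected. It contains
all minima, since their open downset is empty. -/
def initialHull (Q : Type*) [PartialOrder Q] : Set Q := {q | ¬ PosetConnected (Set.Iio q)}

/-- A (not necessarily full) subposet of `Q`: a set of elements of `Q` and a set of relations `p ≤ q`
of `Q` between them (stored as pairs `(p, q)`) which is a partial order on the chosen elements.
Antisymmetry is inherited from `Q`. -/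
structure Subposet (Q : Type*) [PartialOrder Q] where
  obj : Set Q
  rel : Set (Q × Q)
  left_mem : ∀ p q, (p, q) ∈ rel → p ∈ obj
  right_mem : ∀ p q, (p, q) ∈ rel → q ∈ obj
  le_of_rel : ∀ p q, (p, q) ∈ rel → p ≤ q
  rel_refl : ∀ p ∈ obj, (p, p) ∈ rel
  rel_trans : ∀ p q r, (p, q) ∈ rel → (q, r) ∈ rel → (p, r) ∈ rel

/-- `P` is an initial scaffold of `Q`: its elements are those of `I_Q`, and for each element `p` of
`P` and each component `A` of the open downset of `p` in `Q`, there is exactly one relation `m < p`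
in `P` with `m ∈ A`. -/
def Subposet.IsInitialScaffold {Q : Type*} [PartialOrder Q] (P : Subposet Q) : Prop :=
  P.obj = initialHull Q ∧
    ∀ p ∈ P.obj, ∀ A : Set Q, IsPosetComponent (Set.Iio p) A → ∃! m, m ∈ A ∧ (m, p) ∈ P.rel

/-- The size `|P|`: the number of relations of `P`, identity relations included (`0` by convention if
there are infinitely many). -/
noncomputable def Subposet.size {Q : Type*} [PartialOrder Q] (P : Subposet Q) : ℕ := P.rel.ncard

/-! If two elements below `p` are both smaller than `p` in a common coordinate, their join is still
below `p` and lies in `Q` by convexity (`joinedWithin_Iio_of_lt`). So distinct components below `p`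
drop in disjoint nonempty sets of coordinates: there are at most `d` of them, and `|P| ≤ (d + 1)
|I_Q|`. It remains to count `I_Q`.

A nonminimal `p ∈ I_Q` is the join of any two minima in different components below it, whence `|I_Q|
≤ n + n²`. If `d ≤ 3`, one of two disjoint coordinate sets is a single `{i}`, so that component lies
on a line in direction `i` and has one minimum `m`. The pair `(m, i)` determines `p`, whence `|I_Q|
≤ n + d n`. The linear lower bound counts identities at minima.

For `d > 3`, two antidiagonals in complementary coordinate planes generate an upset in which every
join across the two families lies in `I_Q`. -/

/-! ### Path components of open downsets, and initial scaffolds. -/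

section Connectedness

variable {Q : Type*} [PartialOrder Q]

/-- Two elements are joined in `S` if a finite path in `S` with comparable consecutive elements leads
from one to the other. -/
def JoinedWithin (S : Set Q) : Q → Q → Prop :=
  Relation.ReflTransGen fun a b => a ∈ S ∧ b ∈ S ∧ (a ≤ b ∨ b ≤ a)

theorem JoinedWithin.symm {S : Set Q} {x y : Q} (h : JoinedWithin S x y) : JoinedWithin S y x :=
  by
  induction h with
  | refl => exact Relation.ReflTransGen.refl
  | tail _ h ih => exact Relation.ReflTransGen.head ⟨h.2.1, h.1, h.2.2.symm⟩ ih

theorem JoinedWithin.trans {S : Set Q} {x y z : Q} (h : JoinedWithin S x y)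
    (h' : JoinedWithin S y z) : JoinedWithin S x z :=
  Relation.ReflTransGen.trans h h'

theorem JoinedWithin.mono {S T : Set Q} (hST : S ⊆ T) {x y : Q} (h : JoinedWithin S x y) :
    JoinedWithin T x y :=
  by
  induction h with
  | refl => exact Relation.ReflTransGen.refl
  | tail _ h ih => exact ih.tail ⟨hST h.1, hST h.2.1, h.2.2⟩

theorem joinedWithin_of_le {S : Set Q} {x y : Q} (hx : x ∈ S) (hy : y ∈ S) (h : x ≤ y) :
    JoinedWithin S x y :=
  Relation.ReflTransGen.single ⟨hx, hy, Or.inl h⟩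

theorem JoinedWithin.mem {S : Set Q} {x y : Q} (h : JoinedWithin S x y) (hx : x ∈ S) : y ∈ S := by
  induction h with
  | refl => exact hx
  | tail _ h _ => exact h.2.1

theorem posetConnected_iff {S : Set Q} :
    PosetConnected S ↔ S.Nonempty ∧ ∀ x ∈ S, ∀ y ∈ S, JoinedWithin S x y := by
  constructor
  · intro h
    have h' : CategoryTheory.IsConnected S := h
    refine ⟨Set.nonempty_coe_sort.mp h'.is_nonempty, fun x hx y hy => ?_⟩
    have hz := CategoryTheory.isPreconnected_zigzag (⟨x, hx⟩ : S) ⟨y, hy⟩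
    suffices ∀ b : S, CategoryTheory.Zigzag (⟨x, hx⟩ : S) b → JoinedWithin S x b from this _ hz
    intro b hb
    induction hb with
    | refl => exact Relation.ReflTransGen.refl
    | @tail b c _ hbc ih =>
      refine ih.tail ⟨b.2, c.2, ?_⟩
      rcases hbc with ⟨⟨f⟩⟩ | ⟨⟨f⟩⟩
      · exact Or.inl (CategoryTheory.leOfHom f)
      · exact Or.inr (CategoryTheory.leOfHom f)
  · rintro ⟨hne, h⟩
    have : Nonempty S := hne.to_subtype
    refine CategoryTheory.zigzag_isConnected fun a b => ?_
    suffices ∀ y, JoinedWithin S a y → ∀ hy : y ∈ S, CategoryTheory.Zigzag a ⟨y, hy⟩ from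
      this b (h a a.2 b b.2) b.2
    intro y hy
    induction hy with
    | refl => intro _; exact Relation.ReflTransGen.refl
    | tail _ hbc ih =>
      intro hc
      refine Relation.ReflTransGen.tail (ih hbc.1) ?_
      rcases hbc.2.2 with hle | hle
      · exact Or.inl ⟨CategoryTheory.homOfLE hle⟩
      · exact Or.inr ⟨CategoryTheory.homOfLE hle⟩

/-- Every vertex of a path from `x` is itself joined to `x`, so the path never leaves the class of
`x`. -/
theorem joinedWithin_component {S : Set Q} {x y : Q} (h : JoinedWithin S x y) :
    JoinedWithin {z | JoinedWithin S x z} x y := by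
  induction h with
  | refl => exact Relation.ReflTransGen.refl
  | tail hb hbc ih => exact ih.tail ⟨hb, hb.tail hbc, hbc.2.2⟩

theorem isPosetComponent_joinedWithin {S : Set Q} {x : Q} (hx : x ∈ S) :
    IsPosetComponent S {y | JoinedWithin S x y} := by
  refine ⟨⟨fun y hy => hy.mem hx, posetConnected_iff.mpr ⟨⟨x, Relation.ReflTransGen.refl⟩, ?_⟩⟩, ?_⟩
  · intro y hy z hz
    exact (joinedWithin_component hy).symm.trans (joinedWithin_component hz)
  · rintro B ⟨hBS, hB⟩ hle y hy
    exact ((posetConnected_iff.mp hB).2 x (hle Relation.ReflTransGen.refl) y hy).mono hBS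

theorem IsPosetComponent.eq_joinedWithin {S A : Set Q} (hA : IsPosetComponent S A) {x : Q}
    (hx : x ∈ A) : A = {y | JoinedWithin S x y} := by
  have hsub : A ⊆ {y | JoinedWithin S x y} := fun y hy =>
    ((posetConnected_iff.mp hA.1.2).2 x hx y hy).mono hA.1.1
  exact hsub.antisymm (hA.2 (isPosetComponent_joinedWithin (hA.1.1 hx)).1 hsub)

theorem IsPosetComponent.nonempty {S A : Set Q} (hA : IsPosetComponent S A) : A.Nonempty :=
  (posetConnected_iff.mp hA.1.2).1

theorem exists_isMin_le [WellFoundedLT Q] (x : Q) : ∃ m ≤ x, IsMin m := by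
  obtain ⟨m, hm, hmin⟩ := WellFounded.has_min (wellFounded_lt (α := Q)) (Set.Iic x) ⟨x, le_rfl⟩
  refine ⟨m, hm, fun b hb => ?_⟩
  by_contra hmb
  exact hmin b (hb.trans hm) (lt_of_le_not_ge hb hmb)

theorem posetMinima_subset_initialHull : posetMinima Q ⊆ initialHull Q := by
  intro m hm h
  obtain ⟨x, hx⟩ := (posetConnected_iff.mp h).1
  exact hm.not_lt hx

/-- A nonminimal element of `I_Q` lies above two minima that are not joined in its open downset. -/
theorem exists_minima_not_joined [WellFoundedLT Q] {p : Q} (hp : p ∈ initialHull Q)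
    (hmin : ¬ IsMin p) :
    ∃ m m' : Q, IsMin m ∧ IsMin m' ∧ m < p ∧ m' < p ∧ ¬ JoinedWithin (Set.Iio p) m m' := by
  have hne : (Set.Iio p).Nonempty := not_isMin_iff.mp hmin
  have hnot : ¬ PosetConnected (Set.Iio p) := hp
  rw [posetConnected_iff] at hnot
  push Not at hnot
  obtain ⟨x, hx, y, hy, hxy⟩ := hnot hne
  obtain ⟨m, hmx, hm⟩ := exists_isMin_le x
  obtain ⟨m', hmy, hm'⟩ := exists_isMin_le y
  have h1 : m < p := lt_of_le_of_lt hmx hx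
  have h2 : m' < p := lt_of_le_of_lt hmy hy
  refine ⟨m, m', hm, hm', h1, h2, fun h => hxy ?_⟩
  exact ((joinedWithin_of_le (S := Set.Iio p) h1 hx hmx).symm.trans h).trans
    (joinedWithin_of_le h2 hy hmy)

/-- Take a minimal element of `Q` in each component as the source of its relation. Minimal sources
make transitivity automatic. -/
theorem exists_isInitialScaffold [WellFoundedLT Q] : ∃ P : Subposet Q, P.IsInitialScaffold := by
  have hex : ∀ A : Set Q, ∃ m : Q → Q, ∀ q, IsPosetComponent (Set.Iio q) A → m q ∈ A ∧ IsMin (m q) := by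
    intro A
    have : ∀ q, ∃ m, IsPosetComponent (Set.Iio q) A → m ∈ A ∧ IsMin m := by
      intro q
      by_cases hA : IsPosetComponent (Set.Iio q) A
      · obtain ⟨x, hx⟩ := hA.nonempty
        obtain ⟨m, hmx, hm⟩ := exists_isMin_le x
        refine ⟨m, fun _ => ⟨?_, hm⟩⟩
        have hxq := hA.1.1 hx
        rw [hA.eq_joinedWithin hx]
        exact (joinedWithin_of_le (S := Set.Iio q) (lt_of_le_of_lt hmx hxq) hxq hmx).symm
      · exact ⟨q, fun h => absurd h hA⟩
    choose m hm using this
    exact ⟨m, hm⟩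
  choose g hg using hex
  refine ⟨⟨initialHull Q, {r | r.1 = r.2 ∧ r.2 ∈ initialHull Q ∨ r.2 ∈ initialHull Q ∧
    ∃ A, IsPosetComponent (Set.Iio r.2) A ∧ r.1 = g A r.2}, ?_, ?_, ?_, ?_, ?_⟩, rfl, ?_⟩
  · rintro p q (⟨h, hq⟩ | ⟨-, A, hA, h⟩)
    · exact (show p = q from h) ▸ hq
    · exact posetMinima_subset_initialHull ((show p = g A q from h) ▸ (hg A q hA).2)
  · rintro p q (⟨-, hq⟩ | ⟨hq, -⟩) <;> exact hq
  · rintro p q (⟨h, -⟩ | ⟨-, A, hA, h⟩)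
    · exact (show p = q from h).le
    · exact (show p = g A q from h) ▸ (hA.1.1 (hg A q hA).1).le
  · exact fun p hp => Or.inl ⟨rfl, hp⟩
  · rintro p q r (⟨h, hq⟩ | ⟨hq, A, hA, h⟩) (⟨h', hr⟩ | ⟨hr, B, hB, h'⟩)
    · exact Or.inl ⟨h.trans h', hr⟩
    · exact Or.inr ⟨hr, B, hB, h.trans h'⟩
    · exact Or.inr ⟨hr, A, (show q = r from h') ▸ hA, (show q = r from h') ▸ h⟩
    -- Two proper relations never compose: the middle element would be minimal and yet have
    -- something below it.
    · exfalso
      have hlt : p < q := (show p = g A q from h) ▸ hA.1.1 (hg A q hA).1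
      have hm : IsMin q := (show q = g B r from h') ▸ (hg B r hB).2
      exact hm.not_lt hlt
  · intro p hp A hA
    refine ⟨g A p, ⟨(hg A p hA).1, Or.inr ⟨hp, A, hA, rfl⟩⟩, ?_⟩
    rintro m ⟨hmA, ⟨h, -⟩ | ⟨-, B, hB, h⟩⟩
    · exact absurd (show m = p from h) (ne_of_lt (hA.1.1 hmA))
    · have hmB : m ∈ B := (show m = g B p from h) ▸ (hg B p hB).1
      rw [hA.eq_joinedWithin hmA, ← hB.eq_joinedWithin hmB]
      exact h

/-- Relations of an initial scaffold with the same target whose sources are joined in the open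
downset of that target coincide. -/
theorem Subposet.IsInitialScaffold.eq_of_joinedWithin {P : Subposet Q} (hP : P.IsInitialScaffold)
    {m m' p : Q} (hm : (m, p) ∈ P.rel) (hm' : (m', p) ∈ P.rel) (hlt : m < p)
    (h : JoinedWithin (Set.Iio p) m m') : m = m' :=
  (hP.2 p (P.right_mem _ _ hm) _ (isPosetComponent_joinedWithin (S := Set.Iio p) hlt)).unique
    ⟨Relation.ReflTransGen.refl, hm⟩ ⟨h, hm'⟩

/-- The identity relations alone give this bound; finiteness excludes the default value `0` of
`size`. -/
theorem Subposet.IsInitialScaffold.ncard_initialHull_le {P : Subposet Q} (hP : P.IsInitialScaffold)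
    (hfin : P.rel.Finite) : (initialHull Q).ncard ≤ P.size :=
  Set.ncard_le_ncard_of_injOn (fun p => (p, p)) (fun p hp => P.rel_refl p (hP.1 ▸ hp))
    (fun _ _ _ _ h => (Prod.mk.inj h).1) hfin

end Connectedness

/-! ### Upper bounds for intervals of `ℕ^d`. -/

section Intervals

variable {d : ℕ} {Q : Set (Fin d → ℕ)}

/-- Dickson's lemma: minima form an antichain in a well-quasi-order. -/
theorem finite_posetMinima (Q : Set (Fin d → ℕ)) : (posetMinima Q).Finite := by
  have hanti : IsAntichain (· ≤ ·) ((Subtype.val : Q → Fin d → ℕ) '' posetMinima Q) := by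
    rintro _ ⟨a, ha, rfl⟩ _ ⟨b, hb, rfl⟩ hne hle
    exact hne (congrArg Subtype.val (le_antisymm (show a ≤ b from hle) (hb hle)))
  exact (WellQuasiOrderedLE.finite_of_isAntichain hanti).of_finite_image Subtype.val_injective.injOn

/-- Elements below `p` that both differ from `p` in a common coordinate are joined below `p`. -/
theorem joinedWithin_Iio_of_lt (hQ : Q.OrdConnected) {x y p : Q} (hx : x < p) (hy : y < p)
    {i : Fin d} (hxi : x.1 i < p.1 i) (hyi : y.1 i < p.1 i) : JoinedWithin (Set.Iio p) x y := by
  have hz : x.1 ⊔ y.1 ∈ Q := hQ.out x.2 p.2 ⟨le_sup_left, sup_le hx.le hy.le⟩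
  have hzp : (⟨x.1 ⊔ y.1, hz⟩ : Q) ∈ Set.Iio p := by
    refine lt_of_le_of_ne (sup_le hx.le hy.le : x.1 ⊔ y.1 ≤ p.1) fun h => ?_
    exact absurd (congrFun h i) (sup_lt_iff.mpr ⟨hxi, hyi⟩).ne
  exact (joinedWithin_of_le (S := Set.Iio p) hx hzp (le_sup_left : x.1 ≤ x.1 ⊔ y.1)).trans
    (joinedWithin_of_le (S := Set.Iio p) hy hzp (le_sup_right : y.1 ≤ x.1 ⊔ y.1)).symm

theorem exists_coord_lt {x p : Q} (h : x < p) : ∃ i, x.1 i < p.1 i :=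
  (Pi.lt_def.mp (show x.1 < p.1 from h)).2

/-- Label a relation by its target and a coordinate in which the source is smaller, or `none` for an
identity. Proper relations with equal labels have joined sources, hence coincide. -/
theorem Subposet.IsInitialScaffold.rel_finite_and_size_le (hQ : Q.OrdConnected) {P : Subposet Q}
    (hP : P.IsInitialScaffold) (hfin : (initialHull Q).Finite) :
    P.rel.Finite ∧ P.size ≤ (d + 1) * (initialHull Q).ncard := by
  classical
  have hex : ∀ r : Q × Q, ∃ o : Option (Fin d), (o = none ∧ ¬ r.1 < r.2) ∨
      (∃ i, o = some i ∧ r.1 < r.2 ∧ r.1.1 i < r.2.1 i) := by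
    intro r
    by_cases h : r.1 < r.2
    · obtain ⟨i, hi⟩ := exists_coord_lt h
      exact ⟨some i, Or.inr ⟨i, rfl, h, hi⟩⟩
    · exact ⟨none, Or.inl ⟨rfl, h⟩⟩
  choose f hf using hex
  have hmaps : Set.MapsTo (fun r : Q × Q => (r.2, f r)) P.rel
      (initialHull Q ×ˢ (Set.univ : Set (Option (Fin d)))) := by
    rintro ⟨m, p⟩ h
    exact ⟨hP.1 ▸ P.right_mem _ _ h, trivial⟩
  have hinj : Set.InjOn (fun r : Q × Q => (r.2, f r)) P.rel := by
    rintro ⟨m, p⟩ h ⟨m', p'⟩ h' heq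
    obtain ⟨rfl, hfe⟩ : p = p' ∧ f (m, p) = f (m', p') := Prod.mk.inj heq
    rcases hf (m, p) with ⟨h1, h2⟩ | ⟨i, h1, h2, h3⟩ <;>
      rcases hf (m', p) with ⟨h1', h2'⟩ | ⟨i', h1', h2', h3'⟩
    · have e := (P.le_of_rel _ _ h).eq_of_not_lt h2
      have e' := (P.le_of_rel _ _ h').eq_of_not_lt h2'
      rw [e, e']
    · simp [h1, h1'] at hfe
    · simp [h1, h1'] at hfe
    · obtain rfl : i = i' := by simpa [h1, h1'] using hfe
      rw [hP.eq_of_joinedWithin h h' h2 (joinedWithin_Iio_of_lt hQ h2 h2' h3 h3')]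
  have hfin' : (initialHull Q ×ˢ (Set.univ : Set (Option (Fin d)))).Finite :=
    hfin.prod Set.finite_univ
  refine ⟨hfin'.of_injOn hmaps hinj, ?_⟩
  refine (Set.ncard_le_ncard_of_injOn _ hmaps hinj hfin').trans ?_
  rw [Set.ncard_prod, Set.ncard_univ, Nat.card_eq_fintype_card, Fintype.card_option,
    Fintype.card_fin, mul_comm]

/-- If the nonminimal elements of `I_Q` are sent injectively to a finite set, then `I_Q` is finite and
its size is bounded. -/
theorem initialHull_finite_of_injOn {α : Type*} {T : Set α} (hT : T.Finite) (f : Q → α)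
    (hmaps : Set.MapsTo f (initialHull Q \ posetMinima Q) T)
    (hinj : Set.InjOn f (initialHull Q \ posetMinima Q)) :
    (initialHull Q).Finite ∧ (initialHull Q).ncard ≤ (posetMinima Q).ncard + T.ncard := by
  have hfin : (initialHull Q \ posetMinima Q).Finite := hT.of_injOn hmaps hinj
  have hu : initialHull Q = posetMinima Q ∪ (initialHull Q \ posetMinima Q) :=
    (Set.union_sdiff_cancel posetMinima_subset_initialHull).symm
  constructor
  · rw [hu]
    exact (finite_posetMinima Q).union hfin
  · calc (initialHull Q).ncard = (posetMinima Q ∪ (initialHull Q \ posetMinima Q)).ncard := by rw [← hu]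
      _ ≤ (posetMinima Q).ncard + (initialHull Q \ posetMinima Q).ncard := Set.ncard_union_le _ _
      _ ≤ _ := Nat.add_le_add_left (Set.ncard_le_ncard_of_injOn f hmaps hinj hT) _

/-- Minima in different components below `p` cannot both be smaller than `p` in one coordinate, so
their join is `p`. -/
theorem initialHull_finite_and_ncard_le_sq (hQ : Q.OrdConnected) : (initialHull Q).Finite ∧
    (initialHull Q).ncard ≤ (posetMinima Q).ncard + (posetMinima Q).ncard ^ 2 := by
  have hex : ∀ p : Q, ∃ r : Q × Q, p ∈ initialHull Q \ posetMinima Q →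
      r ∈ posetMinima Q ×ˢ posetMinima Q ∧ p.1 = r.1.1 ⊔ r.2.1 := by
    intro p
    by_cases hp : p ∈ initialHull Q \ posetMinima Q
    · obtain ⟨m, m', hm, hm', hmp, hmp', hj⟩ := exists_minima_not_joined hp.1 hp.2
      refine ⟨(m, m'), fun _ => ⟨⟨hm, hm'⟩, ?_⟩⟩
      funext i
      refine le_antisymm ?_ ((sup_le hmp.le hmp'.le : m.1 ⊔ m'.1 ≤ p.1) i)
      by_contra hlt
      obtain ⟨h1, h2⟩ := sup_lt_iff.mp (not_le.mp hlt)
      exact hj (joinedWithin_Iio_of_lt hQ hmp hmp' h1 h2)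
    · exact ⟨(p, p), fun h => absurd h hp⟩
  choose f hf using hex
  have := initialHull_finite_of_injOn ((finite_posetMinima Q).prod (finite_posetMinima Q)) f
    (fun p hp => (hf p hp).1) (fun p hp q hq h => Subtype.ext (by
      rw [(hf p hp).2, (hf q hq).2, h]))
  rwa [Set.ncard_prod, ← sq] at this

/-- In dimension at most three, an element `p` of `I_Q` that is not minimal differs in one coordinate
only from some minimum `m`, which is the only minimum below `p` smaller than `p` in that coordinate,
but not the only minimum below `p`. -/
theorem exists_minimum_differing_in_one_coord (hd : d ≤ 3) (hQ : Q.OrdConnected) {p : Q}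
    (hp : p ∈ initialHull Q) (hmin : ¬ IsMin p) :
    ∃ (m : Q) (i : Fin d), IsMin m ∧ m.1 i < p.1 i ∧ (∀ j ≠ i, m.1 j = p.1 j) ∧
      (∀ m' : Q, IsMin m' → m' < p → m'.1 i < p.1 i → m' = m) ∧
      ∃ m' : Q, IsMin m' ∧ m' ≤ p ∧ m'.1 i = p.1 i := by
  classical
  obtain ⟨x, y, hx, hy, hxp, hyp, hxy⟩ := exists_minima_not_joined hp hmin
  -- The coordinates in which the component of `x` drops below `p`.
  let supp : Q → Finset (Fin d) := fun x =>
    {i | ∃ z : Q, JoinedWithin (Set.Iio p) x z ∧ z.1 i < p.1 i}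
  have key : ∀ x y : Q, IsMin x → IsMin y → x < p → y < p → ¬ JoinedWithin (Set.Iio p) x y →
      (supp x).card ≤ 1 → ∃ (m : Q) (i : Fin d), IsMin m ∧ m.1 i < p.1 i ∧
      (∀ j ≠ i, m.1 j = p.1 j) ∧ (∀ m' : Q, IsMin m' → m' < p → m'.1 i < p.1 i → m' = m) ∧
      ∃ m' : Q, IsMin m' ∧ m' ≤ p ∧ m'.1 i = p.1 i := by
    intro x y hx hy hxp hyp hxy hcard
    obtain ⟨i, hi⟩ := exists_coord_lt hxp
    have hagree : ∀ z : Q, JoinedWithin (Set.Iio p) x z → ∀ j ≠ i, z.1 j = p.1 j := by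
      intro z hz j hj
      refine le_antisymm ((show z.1 ≤ p.1 from (hz.mem hxp : z < p).le) j) (not_lt.mp fun hlt => hj ?_)
      refine Finset.card_le_one.mp hcard j ?_ i ?_
      · simpa [supp] using ⟨z, ⟨z.2, hz⟩, hlt⟩
      · simpa [supp] using ⟨x, ⟨x.2, Relation.ReflTransGen.refl⟩, hi⟩
    refine ⟨x, i, hx, hi, hagree x Relation.ReflTransGen.refl, ?_, y, hy, hyp.le, ?_⟩
    · intro m' hm' hm'p hlt
      have hag := hagree m' (joinedWithin_Iio_of_lt hQ hxp hm'p hi hlt)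
      have hag' := hagree x Relation.ReflTransGen.refl
      -- Both minima lie on one line in direction `i`, so they are comparable and therefore equal.
      rcases le_total (m'.1 i) (x.1 i) with h | h
      · have hle : m' ≤ x := by
          intro j
          by_cases hj : j = i
          · exact hj ▸ h
          · exact ((hag j hj).trans (hag' j hj).symm).le
        exact le_antisymm hle (hx hle)
      · have hle : x ≤ m' := by
          intro j
          by_cases hj : j = i
          · exact hj ▸ h
          · exact ((hag' j hj).trans (hag j hj).symm).le
        exact le_antisymm (hm' hle) hle
    · exact le_antisymm ((show y.1 ≤ p.1 from hyp.le) i)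
        (not_lt.mp fun hlt => hxy (joinedWithin_Iio_of_lt hQ hxp hyp hi hlt))
  have hdisj : Disjoint (supp x) (supp y) := by
    rw [Finset.disjoint_left]
    intro i hi hi'
    obtain ⟨z, hz, hzi⟩ := (Finset.mem_filter.mp hi).2
    obtain ⟨w, hw, hwi⟩ := (Finset.mem_filter.mp hi').2
    exact hxy ((hz.trans (joinedWithin_Iio_of_lt hQ (hz.mem hxp) (hw.mem hyp) hzi hwi)).trans hw.symm)
  have hcard : (supp x).card + (supp y).card ≤ 3 := by
    rw [← Finset.card_union_of_disjoint hdisj]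
    exact (Finset.card_le_univ _).trans (by simpa using hd)
  by_cases h : (supp x).card ≤ 1
  · exact key x y hx hy hxp hyp hxy h
  · exact key y x hy hx hyp hxp (fun h => hxy h.symm) (by omega)

/-- If `p < q` had the same pair `(m, i)`, the minimum below `p` at height `p i` would be a second
minimum below `q` smaller in coordinate `i`. -/
theorem initialHull_finite_and_ncard_le_linear (hd : d ≤ 3) (hQ : Q.OrdConnected) :
    (initialHull Q).Finite ∧
      (initialHull Q).ncard ≤ (posetMinima Q).ncard + (posetMinima Q).ncard * d := by
  have hex : ∀ p : Q, ∃ r : Q × Option (Fin d), p ∈ initialHull Q \ posetMinima Q →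
      ∃ (m : Q) (i : Fin d), r = (m, some i) ∧ IsMin m ∧ m.1 i < p.1 i ∧ (∀ j ≠ i, m.1 j = p.1 j) ∧
      (∀ m' : Q, IsMin m' → m' < p → m'.1 i < p.1 i → m' = m) ∧
      ∃ m' : Q, IsMin m' ∧ m' ≤ p ∧ m'.1 i = p.1 i := by
    intro p
    by_cases hp : p ∈ initialHull Q \ posetMinima Q
    · obtain ⟨m, i, h⟩ := exists_minimum_differing_in_one_coord hd hQ hp.1 hp.2
      exact ⟨(m, some i), fun _ => ⟨m, i, rfl, h⟩⟩
    · exact ⟨(p, none), fun h => absurd h hp⟩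
  choose f hf using hex
  have hmaps : Set.MapsTo f (initialHull Q \ posetMinima Q)
      -- `none` only serves as a default outside the domain; restricting to the range of `some`
      -- leaves `d` labels.
      (posetMinima Q ×ˢ Set.range (some : Fin d → Option (Fin d))) := by
    intro p hp
    obtain ⟨m, i, hr, hm, -⟩ := hf p hp
    rw [hr]
    exact ⟨hm, i, rfl⟩
  have hinj : Set.InjOn f (initialHull Q \ posetMinima Q) := by
    have key : ∀ (p q m : Q) (i : Fin d), m.1 i < p.1 i →
        (∀ j ≠ i, m.1 j = p.1 j) → (∀ j ≠ i, m.1 j = q.1 j) →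
        (∀ m' : Q, IsMin m' → m' < q → m'.1 i < q.1 i → m' = m) →
        (∃ m' : Q, IsMin m' ∧ m' ≤ p ∧ m'.1 i = p.1 i) → ¬ p.1 i < q.1 i := by
      rintro p q m i hlt hp hq huniq ⟨m', hm', hm'p, hm'i⟩ hpq
      have hle : p ≤ q := by
        intro j
        by_cases hj : j = i
        · exact hj ▸ hpq.le
        · exact ((hp j hj).symm.trans (hq j hj)).le
      have hlt' : p < q := lt_of_le_of_ne hle fun h => by simp [h] at hpq
      have := huniq m' hm' (lt_of_le_of_lt hm'p hlt') (hm'i ▸ hpq)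
      rw [this] at hm'i
      exact hlt.ne hm'i
    intro p hp q hq heq
    obtain ⟨m, i, hr, hm, h1, h2, h3, h4⟩ := hf p hp
    obtain ⟨m', i', hr', hm', h1', h2', h3', h4'⟩ := hf q hq
    obtain ⟨rfl, hi⟩ : m = m' ∧ some i = some i' := Prod.mk.inj (hr.symm.trans (heq.trans hr'))
    obtain rfl := Option.some.inj hi
    refine Subtype.ext (funext fun j => ?_)
    by_cases hj : j = i
    · rw [hj]
      exact le_antisymm (not_lt.mp (key q p m i h1' h2' h2 h3 h4'))
        (not_lt.mp (key p q m i h1 h2 h2' h3' h4))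
    · exact (h2 j hj).symm.trans (h2' j hj)
  have := initialHull_finite_of_injOn ((finite_posetMinima Q).prod (Set.finite_range _)) f hmaps hinj
  rwa [Set.ncard_prod, Set.ncard_range_of_injective (Option.some_injective _), Nat.card_eq_fintype_card,
    Fintype.card_fin] at this

theorem IsPosetInterval.one_le_ncard_posetMinima (hQ : IsPosetInterval Q) :
    1 ≤ (posetMinima Q).ncard := by
  obtain ⟨x, hx⟩ := (posetConnected_iff.mp hQ.1).1
  obtain ⟨m, -, hm⟩ := exists_isMin_le (⟨x, hx⟩ : Q)
  exact (Set.ncard_pos (finite_posetMinima Q)).mpr ⟨m, hm⟩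

end Intervals

/-! ### Upsets with quadratically many elements in `I_Q`. -/

section QuadraticExample

/-- Two antidiagonals, of `r` points in the plane of the first two coordinates and of `s` points in the
plane of the next two. -/
def crossedAntidiagonals (d r s : ℕ) : Fin r ⊕ Fin s → Fin d → ℕ
  | .inl i => fun k => if k.val = 0 then i.val + 1 else if k.val = 1 then r - i.val else 0
  | .inr j => fun k => if k.val = 2 then j.val + 1 else if k.val = 3 then s - j.val else 0

variable {d r s : ℕ}

/-- In each of the two planes the join sees only one generator, and an antidiagonal is an antichain.
-/
theorem crossedAntidiagonals_eq_of_le_sup (hd : 3 < d) {t : Fin r ⊕ Fin s} {i : Fin r} {j : Fin s}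
    (h : crossedAntidiagonals d r s t ≤
      crossedAntidiagonals d r s (.inl i) ⊔ crossedAntidiagonals d r s (.inr j)) :
    t = .inl i ∨ t = .inr j := by
  rcases t with t | t
  · have h0 := h ⟨0, by omega⟩
    have h1 := h ⟨1, by omega⟩
    simp [crossedAntidiagonals] at h0 h1
    left
    congr 1
    ext
    omega
  · have h2 := h ⟨2, by omega⟩
    have h3 := h ⟨3, by omega⟩
    simp [crossedAntidiagonals] at h2 h3
    right
    congr 1
    ext
    omega

theorem crossedAntidiagonals_le_iff (hd : 3 < d) {t u : Fin r ⊕ Fin s} :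
    crossedAntidiagonals d r s t ≤ crossedAntidiagonals d r s u ↔ t = u := by
  refine ⟨fun h => ?_, fun h => h ▸ le_rfl⟩
  have h0 := h ⟨0, by omega⟩
  have h1 := h ⟨1, by omega⟩
  have h2 := h ⟨2, by omega⟩
  have h3 := h ⟨3, by omega⟩
  rcases t with t | t <;> rcases u with u | u <;> simp [crossedAntidiagonals] at h0 h1 h2 h3
  · congr 1
    ext
    omega
  · congr 1
    ext
    omega

/-- The upset generated by `crossedAntidiagonals`. -/
def crossedUpset (d r s : ℕ) : Set (Fin d → ℕ) := {x | ∃ t, crossedAntidiagonals d r s t ≤ x}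

theorem isPosetInterval_crossedUpset (hr : 0 < r) : IsPosetInterval (crossedUpset d r s) := by
  have hup : ∀ x ∈ crossedUpset d r s, ∀ y, x ≤ y → y ∈ crossedUpset d r s :=
    fun x ⟨t, ht⟩ y hxy => ⟨t, ht.trans hxy⟩
  refine ⟨posetConnected_iff.mpr ⟨⟨_, .inl ⟨0, hr⟩, le_rfl⟩, fun x hx y hy => ?_⟩, ⟨?_⟩⟩
  · have hz := hup x hx (x ⊔ y) le_sup_left
    exact (joinedWithin_of_le hx hz le_sup_left).trans (joinedWithin_of_le hy hz le_sup_right).symm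
  · exact fun x hx y _ z hz => hup x hx z hz.1

theorem ncard_posetMinima_crossedUpset (hd : 3 < d) :
    (posetMinima (crossedUpset d r s)).ncard = r + s := by
  let f : Fin r ⊕ Fin s → crossedUpset d r s := fun t => ⟨crossedAntidiagonals d r s t, t, le_rfl⟩
  have hf : Function.Injective f := fun t u h =>
    (crossedAntidiagonals_le_iff hd).mp (congrArg Subtype.val h).le
  have hrange : posetMinima (crossedUpset d r s) = Set.range f := by
    ext m
    constructor
    · intro hm
      obtain ⟨t, ht⟩ := m.2
      exact ⟨t, le_antisymm ht (hm ht)⟩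
    · rintro ⟨t, rfl⟩ x hx
      obtain ⟨u, hu⟩ := x.2
      have : u = t := (crossedAntidiagonals_le_iff hd).mp (hu.trans hx)
      subst this
      exact hu
  rw [hrange, Set.ncard_range_of_injective hf]
  simp

theorem mul_le_ncard_initialHull_crossedUpset (hd : 3 < d) (hr : 0 < r) :
    r * s ≤ (initialHull (crossedUpset d r s)).ncard := by
  let p : Fin r × Fin s → crossedUpset d r s := fun t =>
    ⟨crossedAntidiagonals d r s (.inl t.1) ⊔ crossedAntidiagonals d r s (.inr t.2),
      .inl t.1, le_sup_left⟩
  have hp : Function.Injective p := by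
    rintro ⟨i, j⟩ ⟨i', j'⟩ h
    have h' : crossedAntidiagonals d r s (.inl i) ⊔ crossedAntidiagonals d r s (.inr j) =
        crossedAntidiagonals d r s (.inl i') ⊔ crossedAntidiagonals d r s (.inr j') :=
      congrArg Subtype.val h
    have hi := crossedAntidiagonals_eq_of_le_sup hd (le_sup_left.trans h'.le)
    have hj := crossedAntidiagonals_eq_of_le_sup hd (le_sup_right.trans h'.le)
    simp at hi hj
    rw [hi, hj]
  have hmem : Set.range p ⊆ initialHull (crossedUpset d r s) := by
    rintro _ ⟨⟨i, j⟩, rfl⟩ hconn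
    let a : crossedUpset d r s := ⟨crossedAntidiagonals d r s (.inl i), .inl i, le_rfl⟩
    let b : crossedUpset d r s := ⟨crossedAntidiagonals d r s (.inr j), .inr j, le_rfl⟩
    have hab : ¬ a ≤ b := fun h =>
      Sum.inl_ne_inr ((crossedAntidiagonals_le_iff (t := .inl i) (u := .inr j) hd).mp h)
    have hba : ¬ b ≤ a := fun h =>
      Sum.inr_ne_inl ((crossedAntidiagonals_le_iff (t := .inr j) (u := .inl i) hd).mp h)
    have hsup : ∀ x : crossedUpset d r s, a ≤ x → b ≤ x → p (i, j) ≤ x :=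
      fun x h1 h2 => sup_le (show a.1 ≤ x.1 from h1) h2
    have hap : a ≤ p (i, j) := (le_sup_left : a.1 ≤ a.1 ⊔ b.1)
    have hbp : b ≤ p (i, j) := (le_sup_right : b.1 ≤ a.1 ⊔ b.1)
    have ha : a < p (i, j) := lt_of_le_not_ge hap fun h => hba (hbp.trans h)
    have hb : b < p (i, j) := lt_of_le_not_ge hbp fun h => hab (hap.trans h)
    -- A path from `a` stays above `a`: each vertex is above `a` or `b`, and a downward step to one
    -- above `b` would start above `a ⊔ b = p (i, j)`.
    have hinv : ∀ y, JoinedWithin (Set.Iio (p (i, j))) a y → a ≤ y := by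
      intro y hy
      induction hy with
      | refl => exact le_rfl
      | @tail y z _ hyz ih =>
        obtain ⟨hy, hz, hle | hle⟩ := hyz
        · exact ih.trans hle
        · obtain ⟨t, ht⟩ := z.2
          have hz' : z < p (i, j) := hz
          rcases crossedAntidiagonals_eq_of_le_sup hd (ht.trans hz'.le) with rfl | rfl
          · exact ht
          · exact absurd (hsup y ih (le_trans (show b ≤ z from ht) hle)) (not_le_of_gt hy)
    exact hab (hinv b ((posetConnected_iff.mp hconn).2 a ha b hb))
  calc r * s = (Set.range p).ncard := by rw [Set.ncard_range_of_injective hp]; simp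
    _ ≤ _ := Set.ncard_le_ncard hmem
      (initialHull_finite_and_ncard_le_sq (isPosetInterval_crossedUpset hr).2).1

end QuadraticExample

/-! ### The constants. -/

theorem theorem3p9 (d : ℕ) :
    (d ≤ 3 → ∃ c C : ℝ, 0 < c ∧ 0 < C ∧
      ∀ Q : Set (Fin d → ℕ), IsPosetInterval Q →
        ∀ P : Subposet Q, P.IsInitialScaffold →
          (posetMinima Q).Finite ∧ P.rel.Finite ∧
          c * ((posetMinima Q).ncard : ℝ) ≤ (P.size : ℝ) ∧
          (P.size : ℝ) ≤ C * ((posetMinima Q).ncard : ℝ)) ∧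
    (3 < d → ∃ c C : ℝ, 0 < c ∧ 0 < C ∧
      (∀ Q : Set (Fin d → ℕ), IsPosetInterval Q →
        ∀ P : Subposet Q, P.IsInitialScaffold →
          (posetMinima Q).Finite ∧ P.rel.Finite ∧
          (P.size : ℝ) ≤ C * ((posetMinima Q).ncard : ℝ) ^ 2) ∧
      (∀ n : ℕ, 1 ≤ n → ∃ Q : Set (Fin d → ℕ), IsPosetInterval Q ∧
        (posetMinima Q).ncard = n ∧
        (∃ P : Subposet Q, P.IsInitialScaffold) ∧
        ∀ P : Subposet Q, P.IsInitialScaffold → c * (n : ℝ) ^ 2 ≤ (P.size : ℝ))) := by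
  constructor
  · intro hd
    refine ⟨1, ((d + 1) * (1 + d) : ℕ), one_pos, by positivity, fun Q hQ P hP => ?_⟩
    obtain ⟨hfin, hcard⟩ := initialHull_finite_and_ncard_le_linear hd hQ.2
    obtain ⟨hrel, hsize⟩ := hP.rel_finite_and_size_le hQ.2 hfin
    refine ⟨finite_posetMinima Q, hrel, ?_, ?_⟩
    · rw [one_mul]
      exact_mod_cast (Set.ncard_le_ncard posetMinima_subset_initialHull hfin).trans
        (hP.ncard_initialHull_le hrel)
    · have : P.size ≤ (d + 1) * (1 + d) * (posetMinima Q).ncard :=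
        hsize.trans ((Nat.mul_le_mul_left _ hcard).trans (le_of_eq (by ring)))
      exact_mod_cast this
  · intro hd
    -- For balanced `r + s = n`, `n² ≤ 4 r s + 1`. The extra `1`, which matters when `s = 0`, is
    -- absorbed by `n ≤ |P|`, so `1 / 8` suffices. The factor `2` comes from `n + n² ≤ 2 n²`.
    refine ⟨1 / 8, ((d + 1) * 2 : ℕ), by norm_num, by positivity, fun Q hQ P hP => ?_, fun n hn => ?_⟩
    · obtain ⟨hfin, hcard⟩ := initialHull_finite_and_ncard_le_sq hQ.2
      obtain ⟨hrel, hsize⟩ := hP.rel_finite_and_size_le hQ.2 hfin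
      refine ⟨finite_posetMinima Q, hrel, ?_⟩
      have h1 := hQ.one_le_ncard_posetMinima
      have h2 : (initialHull Q).ncard ≤ 2 * (posetMinima Q).ncard ^ 2 := by nlinarith
      have : P.size ≤ (d + 1) * 2 * (posetMinima Q).ncard ^ 2 :=
        hsize.trans ((Nat.mul_le_mul_left _ h2).trans (le_of_eq (by ring)))
      exact_mod_cast this
    · obtain ⟨r, s, hrs, hr, hdiff⟩ : ∃ r s, r + s = n ∧ 0 < r ∧ (r = s ∨ r = s + 1) :=
        ⟨n - n / 2, n / 2, by omega, by omega, by omega⟩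
      have hint := isPosetInterval_crossedUpset (d := d) (s := s) hr
      have hmin := ncard_posetMinima_crossedUpset (r := r) (s := s) hd
      refine ⟨crossedUpset d r s, hint, hmin.trans hrs, exists_isInitialScaffold, fun P hP => ?_⟩
      have hfin := (initialHull_finite_and_ncard_le_sq hint.2).1
      have hsize := hP.ncard_initialHull_le (hP.rel_finite_and_size_le hint.2 hfin).1
      have h1 : n ≤ P.size := by
        rw [← hrs, ← hmin]
        exact (Set.ncard_le_ncard posetMinima_subset_initialHull hfin).trans hsize
      have h2 : r * s ≤ P.size := (mul_le_ncard_initialHull_crossedUpset hd hr).trans hsize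
      have h3 : n ^ 2 ≤ 8 * P.size := by
        rcases hdiff with rfl | rfl <;> subst hrs <;> nlinarith
      have h4 : (n : ℝ) ^ 2 ≤ 8 * P.size := by exact_mod_cast h3
      linarith
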